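/- Let $\Omega\subset\mathbb R^d$ be a bounded domain (nonempty, open, connected), let $Y$ be a real Hilbert space, let $A:L^1(\Omega)\to Y$ be a bounded linear operator with adjoint $A^*:Y\to L^\infty(\Omega)$, i.e. $\int_\Omega (A^*\lambda)\,x=\langle\lambda,Ax\rangle$ for all $x\in L^1(\Omega)$, and let $y\in Y$. For $x\in L^1(\Omega)$ put $\mathcal R(x)=\int_\Omega x\log x$ if $x\ge 0$ a.e., $\int_\Omega x=1$ and $x\log x\in L^1(\Omega)$, and $\mathcal R(x)=\infty$ otherwise (with $0\log 0=0$). Assume that $Ax=y$ for some $x\in L^1(\Omega)$ with $\mathcal R(x)<\infty$. Then the problem $\min\{\mathcal R(x): x\in L^1(\Omega),\ Ax=y\}$ has a unique solution $x^\dagger$, and the following holds. For $y^\delta\in Y$ with $\|y^\delta-y\|\le\delta$, $\delta>0$, and $\gamma>0$, consider the entropic dual gradient method with $\lambda_0=0$, $$x_n=\frac{e^{A^*\lambda_n}}{\int_\Omega e^{A^*\lambda_n}},\qquad \lambda_{n+1}=\lambda_n-\gamma(Ax_n-y^\delta),\qquad n\ge 0.$$ (i) Let $0<\gamma$ and $\gamma\|A\|^2\le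 1$. If the integers $n_\delta$ satisfy $n_\delta\to\infty$ and $\delta^2n_\delta\to0$ as $\delta\to0$, then $\|x_{n_\delta}-x^\dagger\|_{L^1(\Omega)}\to0$ as $\delta\to0$. If in addition $x^\dagger$ satisfies the source condition $$x^\dagger>0\ \text{ and }\ 1+\log x^\dagger=A^*\lambda^\dagger\ \text{ a.e. on }\Omega\text{ for some }\lambda^\dagger\in Y,\tag{S}$$ then for all $0<c_1\le c_2$ there is a constant $C$, independent of $\delta$ and $y^\delta$, such that $\|x_{n_\delta}-x^\dagger\|_{L^1(\Omega)}\le C\delta^{1/2}$ whenever $c_1\delta^{-1}\le n_\delta\le c_2\delta^{-1}$. (ii) Let $\tau>1$ and $\gamma>0$ satisfy $1-2/\tau-\|A\|^2\gamma>0$. Then the discrepancy principle $$\|Ax_{n_\delta}-y^\delta\|\le\tau\delta<\|Ax_n-y^\delta\|,\qquad 0\le n<n_\delta,$$ defines a unique finite integer $n_\delta\ge 0$, and $\|x_{n_\delta}-x^\dagger\|_{L^1(\Omega)}\to0$ as $\delta\to0$. If in addition (S) holds, then $\|x_{n_\delta}-x^\dagger\|_{L^1(\Omega)}\le C\delta^{1/2}$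 with a constant $C$ independent of $\delta$ and $y^\delta$. -/

import Mathlib

open MeasureTheory Filter Topology
open scoped ENNReal

noncomputable section

namespace EntropicDual

/-- A bounded domain of `ℝ^d`: a nonempty, connected, open, bounded set. -/
structure BoundedDomain (d : ℕ) where
  carrier : Set (EuclideanSpace ℝ (Fin d))
  isOpen : IsOpen carrier
  isConnected : IsConnected carrier
  isBounded : Bornology.IsBounded carrier

/-- Lebesgue measure on the domain. -/
def BoundedDomain.measure {d : ℕ} (Ω : BoundedDomain d) :
    Measure (EuclideanSpace ℝ (Fin d)) :=
  volume.restrict Ω.carrier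

instance {d : ℕ} (Ω : BoundedDomain d) : IsFiniteMeasure Ω.measure :=
  ⟨by simpa [BoundedDomain.measure] using Ω.isBounded.measure_lt_top⟩

section General

variable {α : Type*} [MeasurableSpace α] {μ : Measure α}

/-- Every bounded linear functional on `L¹` of a finite measure space is integration against an
`L^∞` function. -/
theorem exists_Linfty_representation [IsFiniteMeasure μ] (φ : Lp ℝ 1 μ →L[ℝ] ℝ) :
    ∃ g : Lp ℝ ∞ μ, ∀ x : Lp ℝ 1 μ, ∫ ω, g ω * x ω ∂μ = φ x := by
  let ι : Lp ℝ 2 μ →L[ℝ] Lp ℝ 1 μ :=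
    (ContinuousLinearMap.mul ℝ ℝ).holderL μ 2 2 1 (Lp.const 2 μ (1 : ℝ))
  have hι : ∀ f : Lp ℝ 2 μ, ι f =ᵐ[μ] f := by
    intro f
    have h := ContinuousLinearMap.coeFn_holder (r := 1) (ContinuousLinearMap.mul ℝ ℝ)
      (Lp.const 2 μ (1 : ℝ)) f
    filter_upwards [h, Lp.coeFn_const 2 μ (1 : ℝ)] with ω h1 h2
    change ((ContinuousLinearMap.mul ℝ ℝ).holder 1 (Lp.const 2 μ (1 : ℝ)) f : α → ℝ) ω = f ω
    rw [h1, h2]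
    simp
  let g : Lp ℝ 2 μ := (InnerProductSpace.toDual ℝ (Lp ℝ 2 μ)).symm (φ ∘L ι)
  have hgint : Integrable g μ := (Lp.memLp g).integrable (by norm_num)
  have hset : ∀ (s : Set α) (hs : MeasurableSet s),
      ∫ ω in s, g ω ∂μ = φ (indicatorConstLp 1 hs (measure_ne_top μ s) (1 : ℝ)) := by
    intro s hs
    rw [← L2.inner_indicatorConstLp_one (𝕜 := ℝ) hs (measure_ne_top μ s) g, real_inner_comm]
    rw [InnerProductSpace.toDual_symm_apply]
    change φ (ι _) = _
    congr 1
    refine Lp.ext ?_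
    exact (hι _).trans (indicatorConstLp_coeFn.trans indicatorConstLp_coeFn.symm)
  have habs : ∀ (s : Set α), MeasurableSet s → |∫ ω in s, g ω ∂μ| ≤ ‖φ‖ * μ.real s := by
    intro s hs
    rw [hset s hs, ← Real.norm_eq_abs]
    refine (φ.le_opNorm _).trans ?_
    gcongr
    refine norm_indicatorConstLp_le.trans ?_
    simp
  have hub : g ≤ᵐ[μ] fun _ => ‖φ‖ := by
    refine ae_le_of_forall_setIntegral_le hgint (integrable_const _) fun s hs _ => ?_
    have := (le_abs_self _).trans (habs s hs)
    simpa [mul_comm] using this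
  have hlb : (fun _ => -‖φ‖) ≤ᵐ[μ] g := by
    refine ae_le_of_forall_setIntegral_le (integrable_const _) hgint fun s hs _ => ?_
    have := (abs_le.1 (habs s hs)).1
    simpa [mul_comm] using this
  have hmem : MemLp g ∞ μ := by
    refine memLp_top_of_bound hgint.1 ‖φ‖ ?_
    filter_upwards [hub, hlb] with ω h1 h2
    rw [Real.norm_eq_abs]
    exact abs_le.2 ⟨h2, h1⟩
  refine ⟨hmem.toLp g, fun x => ?_⟩
  have hpair : ∀ x : Lp ℝ 1 μ, ∫ ω, (hmem.toLp g) ω * x ω ∂μ =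
      (ContinuousLinearMap.mul ℝ ℝ).lpPairing μ ∞ 1 (hmem.toLp g) x := by
    intro x
    rw [ContinuousLinearMap.lpPairing_eq_integral]
    simp
  rw [hpair]
  induction x using Lp.induction ENNReal.one_ne_top with
  | indicatorConst c hs hμs =>
    rename_i s
    rw [← hpair, Lp.simpleFunc.coe_indicatorConst]
    have h1 : indicatorConstLp 1 hs hμs.ne c = c • indicatorConstLp 1 hs hμs.ne (1 : ℝ) := by
      refine Lp.ext ?_
      filter_upwards [indicatorConstLp_coeFn (p := 1) (hs := hs) (hμs := hμs.ne) (c := c),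
        indicatorConstLp_coeFn (p := 1) (hs := hs) (hμs := hμs.ne) (c := (1 : ℝ)),
        Lp.coeFn_smul c (indicatorConstLp 1 hs hμs.ne (1 : ℝ))] with ω a b e
      rw [a, e, Pi.smul_apply, b]
      by_cases h : ω ∈ s <;> simp [h]
    have h2 : ∫ ω, (hmem.toLp g) ω * (indicatorConstLp 1 hs hμs.ne c : Lp ℝ 1 μ) ω ∂μ
        = ∫ ω, s.indicator (fun ω => g ω * c) ω ∂μ := by
      refine integral_congr_ae ?_
      filter_upwards [indicatorConstLp_coeFn (p := 1) (hs := hs) (hμs := hμs.ne) (c := c),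
        hmem.coeFn_toLp] with ω a b
      rw [a, b]
      by_cases h : ω ∈ s <;> simp [h]
    rw [h2, integral_indicator hs, integral_mul_const, hset s hs, h1, map_smul, smul_eq_mul,
      mul_comm]
  | add hf hg _ h1 h2 => rw [map_add, map_add, h1, h2]
  | isClosed => exact isClosed_eq (ContinuousLinearMap.continuous _) φ.continuous

variable {Y : Type*} [NormedAddCommGroup Y] [InnerProductSpace ℝ Y]

theorem exists_adjoint [IsFiniteMeasure μ] (A : Lp ℝ 1 μ →L[ℝ] Y) (lam : Y) :
    ∃ g : Lp ℝ ∞ μ, ∀ x : Lp ℝ 1 μ, ∫ ω, g ω * x ω ∂μ = inner ℝ lam (A x) := by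
  simpa using exists_Linfty_representation ((innerSL ℝ lam) ∘L A)

/-- The adjoint `A^* : Y → (L¹)^* = L^∞` of a bounded linear operator `A : L¹ → Y`. -/
def adj [IsFiniteMeasure μ] (A : Lp ℝ 1 μ →L[ℝ] Y) (lam : Y) : Lp ℝ ∞ μ :=
  (exists_adjoint A lam).choose

/-- The defining property `⟨A^* λ, x⟩ = ⟨λ, A x⟩` of the adjoint. -/
theorem adj_spec [IsFiniteMeasure μ] (A : Lp ℝ 1 μ →L[ℝ] Y) (lam : Y) (x : Lp ℝ 1 μ) :
    ∫ ω, adj A lam ω * x ω ∂μ = inner ℝ lam (A x) :=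
  (exists_adjoint A lam).choose_spec x

/-- The property determines the adjoint. -/
theorem adj_unique [IsFiniteMeasure μ] (A : Lp ℝ 1 μ →L[ℝ] Y) (lam : Y) (g : Lp ℝ ∞ μ)
    (hg : ∀ x : Lp ℝ 1 μ, ∫ ω, g ω * x ω ∂μ = inner ℝ lam (A x)) : g = adj A lam := by
  refine Lp.ext ?_
  have hi : ∀ f : Lp ℝ ∞ μ, Integrable f μ := fun f => (Lp.memLp f).integrable (by simp)
  have key : ∀ (f : Lp ℝ ∞ μ) (s : Set α) (hs : MeasurableSet s),
      ∫ ω, f ω * (indicatorConstLp 1 hs (measure_ne_top μ s) (1 : ℝ) : Lp ℝ 1 μ) ω ∂μ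
        = ∫ ω in s, f ω ∂μ := by
    intro f s hs
    rw [← integral_indicator hs]
    refine integral_congr_ae ?_
    filter_upwards [indicatorConstLp_coeFn (p := 1) (hs := hs)
      (hμs := measure_ne_top μ s) (c := (1 : ℝ))] with ω a
    rw [a]
    by_cases h : ω ∈ s <;> simp [h]
  refine Integrable.ae_eq_of_forall_setIntegral_eq _ _ (hi _) (hi _) fun s hs _ => ?_
  rw [← key g s hs, ← key (adj A lam) s hs, hg, adj_spec]

/-- The negative Boltzmann-Shannon entropy `f(x) = ∫ x log x`, equal to `∞` unless `x ≥ 0` a.e.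
and `x log x` is integrable (`0 log 0 = 0`). -/
def negEntropy (x : Lp ℝ 1 μ) : EReal :=
  open Classical in
  if (∀ᵐ ω ∂μ, 0 ≤ x ω) ∧ Integrable (fun ω => x ω * Real.log (x ω)) μ then
    ((∫ ω, x ω * Real.log (x ω) ∂μ : ℝ) : EReal)
  else ⊤

variable (μ) in
/-- The set `Δ` of probability density functions in `L¹`. -/
def densities : Set (Lp ℝ 1 μ) :=
  {x | (∀ᵐ ω ∂μ, 0 ≤ x ω) ∧ ∫ ω, x ω ∂μ = 1}

/-- The functional `R = f + δ_Δ`, with `δ_Δ` the (convex analysis) indicator function of `Δ`. -/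
def entropyFunctional (x : Lp ℝ 1 μ) : EReal :=
  open Classical in
  negEntropy x + (if x ∈ densities μ then 0 else ⊤)

/-- `x` solves the problem `min {R(z) : z ∈ L¹, A z = y}`. -/
def IsEntropySolution (A : Lp ℝ 1 μ →L[ℝ] Y) (y : Y) (x : Lp ℝ 1 μ) : Prop :=
  A x = y ∧ ∀ z : Lp ℝ 1 μ, A z = y → entropyFunctional x ≤ entropyFunctional z

theorem memLp_gibbs [IsFiniteMeasure μ] (l : Lp ℝ ∞ μ) :
    MemLp (fun ω => Real.exp (l ω) / ∫ ω', Real.exp (l ω') ∂μ) 1 μ := by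
  have hb : ∀ᵐ ω ∂μ, ‖l ω‖ ≤ ‖l‖ := by
    filter_upwards [ae_le_eLpNormEssSup (f := (l : α → ℝ)) (μ := μ)] with ω hω
    rw [Lp.norm_def, eLpNorm_exponent_top, ← toReal_enorm]
    have hfin : eLpNormEssSup (l : α → ℝ) μ ≠ ∞ := by
      have := Lp.eLpNorm_ne_top l
      rwa [eLpNorm_exponent_top] at this
    exact ENNReal.toReal_mono hfin hω
  have : MemLp (fun ω => Real.exp (l ω)) 1 μ := by
    refine MemLp.of_bound
      (Real.continuous_exp.comp_aestronglyMeasurable (Lp.aestronglyMeasurable l))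
      (Real.exp ‖l‖) ?_
    filter_upwards [hb] with ω hω
    rw [Real.norm_eq_abs, Real.abs_exp]
    exact Real.exp_le_exp.2 ((le_abs_self _).trans hω)
  simpa [div_eq_mul_inv] using this.mul_const (∫ ω', Real.exp (l ω') ∂μ)⁻¹

/-- The density `e^l / ∫ e^l` in `L¹`, for `l ∈ L^∞`. -/
def gibbs [IsFiniteMeasure μ] (l : Lp ℝ ∞ μ) : Lp ℝ 1 μ := (memLp_gibbs l).toLp _

/-- The dual iterates of the entropic dual gradient method with data `yd`:
`λ_0 = 0` and `λ_{n+1} = λ_n - γ (A x_n - yd)` with `x_n = e^{A^* λ_n} / ∫ e^{A^* λ_n}`. -/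
def dualIterate [IsFiniteMeasure μ] (A : Lp ℝ 1 μ →L[ℝ] Y) (γ : ℝ) (yd : Y) : ℕ → Y
  | 0 => 0
  | n + 1 => dualIterate A γ yd n - γ • (A (gibbs (adj A (dualIterate A γ yd n))) - yd)

/-- The primal iterates `x_n = e^{A^* λ_n} / ∫ e^{A^* λ_n}`. -/
def primalIterate [IsFiniteMeasure μ] (A : Lp ℝ 1 μ →L[ℝ] Y) (γ : ℝ) (yd : Y) (n : ℕ) :
    Lp ℝ 1 μ :=
  gibbs (adj A (dualIterate A γ yd n))

/-- `n` is the stopping index of the discrepancy principle: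
`‖A x_n - yd‖ ≤ τ δ < ‖A x_m - yd‖` for all `m < n`. -/
def IsDiscrepancyIndex [IsFiniteMeasure μ] (A : Lp ℝ 1 μ →L[ℝ] Y) (γ τ δ : ℝ) (yd : Y)
    (n : ℕ) : Prop :=
  ‖A (primalIterate A γ yd n) - yd‖ ≤ τ * δ ∧
    ∀ m < n, τ * δ < ‖A (primalIterate A γ yd m) - yd‖

/-- The source condition `1 + log x = A^* λ` a.e. for some `λ ∈ Y`; that the logarithm makes sense,
i.e. `x > 0` a.e., is part of it. -/
def SourceCondition [IsFiniteMeasure μ] (A : Lp ℝ 1 μ →L[ℝ] Y) (x : Lp ℝ 1 μ) : Prop :=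
  ∃ lam : Y, ∀ᵐ ω ∂μ, 0 < x ω ∧ 1 + Real.log (x ω) = adj A lam ω

end General

end EntropicDual

end

/-!
Write `p_v = e^{A^* v} / ∫ e^{A^* v}`. The proof rests on the identity
`KL(x†, p_v) = R(x†) - ⟨v, y⟩ + log ∫ e^{A^* v} =: B(v)`, valid for every feasible `x†`: up to a
constant the Kullback-Leibler divergence is the dual objective, whose gradient is `A p_v - y`. The
method is thus gradient descent for `B`, perturbed by the noise `y - yᵟ`, and the inequality of
Pinsker type `‖x† - p_v‖² ≤ 4 B(v)` (`norm_sub_gibbs_sq_le`) turns bounds on `B` into bounds on the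
error in `L¹`. `B` is convex, since its Bregman distance is again a Kullback-Leibler divergence, and
its gradient is `‖A‖²`-Lipschitz by Hoeffding's lemma (`logPartition_le`).

Duality (`exists_primal_optimal`): for any feasible `z` of finite entropy, the densities `p_v` along
a suitable minimizing sequence of the dual objective are Cauchy in `L¹`; their limit is feasible and,
by Fatou's lemma, its entropy does not exceed the dual value. So it is a solution, and `inf B = 0`
for it, whether or not the infimum is attained. Uniqueness follows, because the same `p_v` converge
to every solution. The source condition says precisely that the infimum is attained.

Both stopping rules rest on one quantity that decreases along the iteration
(`SmoothConvex.potential_le`), with `D(v) = B(v) + ⟨y - yᵟ, v⟩`: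
`‖λ_n - w‖² + 2 γ n (D(λ_n) - D(w)) + γ² s n (n - 1) / 2`, where `s` is a lower bound for the squared
residuals before `n`. With `s = 0` it gives
`B(λ_n) ≤ B(w) + ‖w‖² / (2 γ n) + γ n δ² / 2` (`SmoothConvex.error_le`). Under the discrepancy
principle `s = (τ δ)²`, and as `τ > 2` the quadratic term absorbs the noise, so that `‖λ_n - w‖`
stays controlled; with the gradient bound `‖A p_v - y‖ ≤ (τ + 1) δ` at the stopping index, convexity
yields `SmoothConvex.error_le_of_discrepancy`. Finally `B(w)` is made small by the choice of `w`, or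
zero under the source condition.
-/

namespace EntropicDual

/-! ### Gradient descent for smooth convex functions on a Hilbert space -/

section GradientDescent

variable {Y : Type*} [NormedAddCommGroup Y] [InnerProductSpace ℝ Y]

/-- `B` is convex with gradient `g`, and `g` is `L²`-Lipschitz; both are expressed by the
first-order bounds on `B` that the analysis of gradient descent uses. -/
structure SmoothConvex (B : Y → ℝ) (g : Y → Y) (L : ℝ) : Prop where
  le : ∀ a b, B a + inner ℝ (g a) (b - a) ≤ B b
  ge : ∀ a b, B b ≤ B a + inner ℝ (g a) (b - a) + L ^ 2 / 2 * ‖b - a‖ ^ 2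

namespace SmoothConvex

variable {B : Y → ℝ} {g : Y → Y} {L γ δ τ : ℝ} {u : ℕ → Y} {e : Y}

theorem add_inner (h : SmoothConvex B g L) (e : Y) :
    SmoothConvex (fun v => B v + inner ℝ e v) (fun v => g v + e) L := by
  constructor <;> intro a b
  · have := h.le a b
    simp only [inner_add_left, inner_sub_right] at this ⊢
    linarith
  · have := h.ge a b
    simp only [inner_add_left, inner_sub_right] at this ⊢
    linarith

/-- The descent lemma for a gradient step of length `γ` perturbed by `e`. -/
theorem step_le (h : SmoothConvex B g L) (γ : ℝ) (v e : Y) :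
    B (v - γ • (g v + e)) ≤
      B v - γ * inner ℝ (g v) (g v + e) + L ^ 2 / 2 * (γ ^ 2 * ‖g v + e‖ ^ 2) := by
  have := h.ge v (v - γ • (g v + e))
  rw [sub_sub_cancel_left, norm_neg, norm_smul, inner_neg_right, inner_smul_right, mul_pow,
    Real.norm_eq_abs, sq_abs] at this
  linarith

theorem step_le_sub (h : SmoothConvex B g L) (hγ : 0 ≤ γ) (hL : γ * L ^ 2 ≤ 1) (v : Y) :
    B (v - γ • g v) ≤ B v - γ / 2 * ‖g v‖ ^ 2 := by
  have h1 := h.step_le γ v 0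
  rw [add_zero, real_inner_self_eq_norm_sq] at h1
  have h2 : γ * L ^ 2 * (γ * ‖g v‖ ^ 2) ≤ 1 * (γ * ‖g v‖ ^ 2) := by gcongr
  linarith

theorem norm_step_sub_sq_le (h : SmoothConvex B g L) (hγ : 0 ≤ γ) (hL : γ * L ^ 2 ≤ 1) (v w : Y) :
    ‖v - γ • g v - w‖ ^ 2 ≤ ‖v - w‖ ^ 2 - 2 * γ * (B (v - γ • g v) - B w) := by
  have h1 := h.step_le_sub hγ hL v
  have h2 := h.le v w
  rw [sub_right_comm, norm_sub_sq_real, inner_smul_right, norm_smul, mul_pow, Real.norm_eq_abs,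
    sq_abs, real_inner_comm]
  rw [← neg_sub v w, inner_neg_right] at h2
  have h3 : γ * (B (v - γ • g v) - B w) ≤ γ * (inner ℝ (g v) (v - w) - γ / 2 * ‖g v‖ ^ 2) :=
    mul_le_mul_of_nonneg_left (by linarith) hγ
  linarith

theorem norm_gradient_sq_le (h : SmoothConvex B g L) {m : ℝ} (hm : ∀ w, m ≤ B w) (v : Y) :
    ‖g v‖ ^ 2 ≤ 2 * (L ^ 2 + 1) * (B v - m) := by
  have hpos : 0 < L ^ 2 + 1 := by positivity
  have h1 := h.step_le_sub (γ := 1 / (L ^ 2 + 1)) (by positivity)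
    (by rw [div_mul_eq_mul_div, one_mul, div_le_one hpos]; linarith) v
  have h2 : 1 / (L ^ 2 + 1) / 2 * ‖g v‖ ^ 2 ≤ B v - m := by
    linarith [hm (v - (1 / (L ^ 2 + 1)) • g v)]
  calc ‖g v‖ ^ 2 = 2 * (L ^ 2 + 1) * (1 / (L ^ 2 + 1) / 2 * ‖g v‖ ^ 2) := by field_simp
    _ ≤ _ := by gcongr

theorem continuous (h : SmoothConvex B g L) : Continuous B := by
  refine continuous_iff_continuousAt.2 fun a => ?_
  refine tendsto_of_tendsto_of_tendsto_of_le_of_le (g := fun b => B a + inner ℝ (g a) (b - a))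
    (h := fun b => B a + inner ℝ (g a) (b - a) + L ^ 2 / 2 * ‖b - a‖ ^ 2) ?_ ?_ (h.le a) (h.ge a)
  · exact Continuous.tendsto' (by fun_prop) _ _ (by simp)
  · exact Continuous.tendsto' (by fun_prop) _ _ (by simp)

/-- The witness minimizes `B` on the segment from the origin to `v`. -/
theorem exists_le_inner_nonpos (h : SmoothConvex B g L) (v : Y) :
    ∃ w, B w ≤ B v ∧ inner ℝ (g w) w ≤ 0 := by
  obtain ⟨t, ht, hmin⟩ := (isCompact_Icc (a := (0 : ℝ)) (b := 1)).exists_isMinOn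
    (Set.nonempty_Icc.2 zero_le_one)
    (f := fun t => B (t • v)) (h.continuous.comp (by fun_prop)).continuousOn
  refine ⟨t • v, by simpa using isMinOn_iff.1 hmin 1 (by simp), ?_⟩
  set w := t • v with hw
  by_contra! ha
  set a := inner ℝ (g w) w
  have hK : 0 ≤ L ^ 2 / 2 * ‖w‖ ^ 2 := by positivity
  set K := L ^ 2 / 2 * ‖w‖ ^ 2 with hKdef
  -- at this fraction of the way back to the origin the linear decrease beats the quadratic error
  set s := a / (a + K + 1) with hs
  have hs0 : 0 < s := by positivity
  have hs1 : s ≤ 1 := (div_le_one (by positivity)).2 (by linarith)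
  have h1 : B w ≤ B (w - s • w) := by
    have := isMinOn_iff.1 hmin ((1 - s) * t)
      ⟨mul_nonneg (by linarith) ht.1, by nlinarith [ht.1, ht.2]⟩
    rwa [mul_smul, ← hw, sub_smul, one_smul] at this
  have h2 := h.ge w (w - s • w)
  rw [sub_sub_cancel_left, norm_neg, norm_smul, inner_neg_right, inner_smul_right, mul_pow,
    Real.norm_eq_abs, sq_abs] at h2
  have h3 : s * a ≤ s * (s * K) := by
    have : L ^ 2 / 2 * (s ^ 2 * ‖w‖ ^ 2) = s * (s * K) := by rw [hKdef]; ring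
    linarith
  have h4 : a ≤ s * K := le_of_mul_le_mul_left h3 hs0
  have h5 : s * (a + K + 1) = a := by rw [hs]; field_simp
  nlinarith

/-- The quantity on the left is nonincreasing in `n` along gradient descent, as long as the squared
gradient norms stay above `s`. -/
theorem potential_le (h : SmoothConvex B g L) (hγ : 0 ≤ γ) (hL : γ * L ^ 2 ≤ 1) (hu0 : u 0 = 0)
    (hu : ∀ n, u (n + 1) = u n - γ • g (u n)) (w : Y) {s : ℝ} {n : ℕ}
    (hs : ∀ k < n, s ≤ ‖g (u k)‖ ^ 2) :
    ‖u n - w‖ ^ 2 + 2 * γ * n * (B (u n) - B w) + γ ^ 2 * s * (n * (n - 1) / 2) ≤ ‖w‖ ^ 2 := by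
  induction n with
  | zero => simp [hu0]
  | succ n ih =>
    refine le_trans ?_ (ih fun k hk => hs k (hk.trans n.lt_succ_self))
    have h1 := h.step_le_sub hγ hL (u n)
    have h2 := h.norm_step_sub_sq_le hγ hL (u n) w
    rw [← hu] at h1 h2
    have h3 : γ * n * (B (u (n + 1)) - B (u n)) ≤ γ * n * (- (γ / 2 * s)) := by
      have := hs n n.lt_succ_self
      gcongr
      have : γ / 2 * s ≤ γ / 2 * ‖g (u n)‖ ^ 2 := by gcongr
      linarith
    push_cast
    nlinarith

/-- Perturbed gradient descent stopped at an arbitrary index: the error bound behind a priori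
stopping rules. -/
theorem error_le (h : SmoothConvex B g L) (hγ : 0 ≤ γ) (hL : γ * L ^ 2 ≤ 1) (hu0 : u 0 = 0)
    (hu : ∀ n, u (n + 1) = u n - γ • (g (u n) + e)) (he : ‖e‖ ≤ δ) (w : Y) (n : ℕ) :
    2 * γ * n * (B (u n) - B w) ≤ ‖w‖ ^ 2 + (γ * n * δ) ^ 2 := by
  have h1 := (h.add_inner e).potential_le hγ hL hu0 hu w (s := 0) (n := n)
    fun _ _ => by positivity
  have h2 : -(δ * ‖u n - w‖) ≤ inner ℝ e (u n - w) := by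
    have := (abs_le.1 (abs_real_inner_le_norm e (u n - w))).1
    have : ‖e‖ * ‖u n - w‖ ≤ δ * ‖u n - w‖ := by gcongr
    linarith
  rw [inner_sub_right] at h2
  have h3 : 2 * γ * n * -(δ * ‖u n - w‖) ≤ 2 * γ * n * (inner ℝ e (u n) - inner ℝ e w) := by
    gcongr
  nlinarith [sq_nonneg (‖u n - w‖ - γ * n * δ)]

/-- While the residual exceeds `τ δ`, the unperturbed objective decreases. -/
theorem perturbed_step_le (h : SmoothConvex B g L) (hγ : 0 < γ) (hτ : 1 < τ) (hδ : 0 < δ)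
    (hL : 0 < 1 - 2 / τ - L ^ 2 * γ) (he : ‖e‖ ≤ δ) {v : Y} (hv : τ * δ < ‖g v + e‖) :
    B (v - γ • (g v + e)) ≤ B v - γ / 2 * (τ * δ) ^ 2 := by
  have h1 := h.step_le γ v e
  set r := g v + e
  have hg : g v = r - e := by simp [r]
  have hτ0 : 0 < τ := by linarith
  have h2 : inner ℝ e r ≤ ‖r‖ ^ 2 / τ := by
    have := real_inner_le_norm e r
    have h4 : ‖e‖ ≤ ‖r‖ / τ := by
      rw [le_div_iff₀ hτ0]
      nlinarith
    calc _ ≤ ‖e‖ * ‖r‖ := this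
      _ ≤ ‖r‖ / τ * ‖r‖ := by gcongr
      _ = _ := by ring
  have h5 : inner ℝ (g v) r = ‖r‖ ^ 2 - inner ℝ e r := by
    rw [hg, inner_sub_left, real_inner_self_eq_norm_sq]
  have h6 : (τ * δ) ^ 2 ≤ ‖r‖ ^ 2 := by gcongr
  have h7 : 0 ≤ γ * ‖r‖ ^ 2 / 2 * (1 - 2 / τ - L ^ 2 * γ) := by positivity
  rw [h5] at h1
  have h8 : γ * inner ℝ e r ≤ γ * (‖r‖ ^ 2 / τ) := by gcongr
  have h9 : γ / 2 * (τ * δ) ^ 2 ≤ γ / 2 * ‖r‖ ^ 2 := by gcongr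
  have h10 : γ * ‖r‖ ^ 2 / 2 * (1 - 2 / τ - L ^ 2 * γ) =
    γ * ‖r‖ ^ 2 / 2 - γ * (‖r‖ ^ 2 / τ) - L ^ 2 / 2 * (γ ^ 2 * ‖r‖ ^ 2) := by ring
  linarith

/-- The number of iterations before the discrepancy principle stops is `O(δ⁻²)`. -/
theorem natCast_mul_le (h : SmoothConvex B g L) (hB : ∀ v, 0 ≤ B v) (hγ : 0 < γ) (hτ : 1 < τ)
    (hδ : 0 < δ) (hL : 0 < 1 - 2 / τ - L ^ 2 * γ) (he : ‖e‖ ≤ δ) (hu0 : u 0 = 0)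
    (hu : ∀ n, u (n + 1) = u n - γ • (g (u n) + e)) {n : ℕ}
    (hn : ∀ k < n, τ * δ < ‖g (u k) + e‖) :
    n * (γ / 2 * (τ * δ) ^ 2) ≤ B 0 := by
  suffices h1 : B (u n) + n * (γ / 2 * (τ * δ) ^ 2) ≤ B 0 by linarith [hB (u n)]
  induction n with
  | zero => simp [hu0]
  | succ n ih =>
    have h1 := ih fun k hk => hn k (hk.trans n.lt_succ_self)
    have h2 := h.perturbed_step_le hγ hτ hδ hL he (hn n n.lt_succ_self)
    rw [← hu] at h2
    push_cast
    linarith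

/-- The residual cannot exceed `τ δ` forever. -/
theorem exists_residual_le (h : SmoothConvex B g L) (hB : ∀ v, 0 ≤ B v) (hγ : 0 < γ) (hτ : 1 < τ)
    (hδ : 0 < δ) (hL : 0 < 1 - 2 / τ - L ^ 2 * γ) (he : ‖e‖ ≤ δ) (hu0 : u 0 = 0)
    (hu : ∀ n, u (n + 1) = u n - γ • (g (u n) + e)) :
    ∃ n, ‖g (u n) + e‖ ≤ τ * δ := by
  by_contra! hcon
  have hpos : 0 < γ / 2 * (τ * δ) ^ 2 := by positivity
  obtain ⟨n, hn⟩ := exists_nat_gt (B 0 / (γ / 2 * (τ * δ) ^ 2))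
  rw [div_lt_iff₀ hpos] at hn
  linarith [h.natCast_mul_le hB hγ hτ hδ hL he hu0 hu (n := n) fun k _ => hcon k]

/-- Perturbed gradient descent stopped by the discrepancy principle. The second term on the right is
a bound for the gradient norm at the stopping index times `‖u n - w‖`; the latter is bounded by
`potential_le` and by the bound on the stopping index from `natCast_mul_le`. -/
theorem error_le_of_discrepancy (h : SmoothConvex B g L) (hB : ∀ v, 0 ≤ B v) (hγ : 0 < γ)
    (hτ : 1 < τ) (hδ : 0 < δ) (hδ1 : δ ≤ 1) (hL : 0 < 1 - 2 / τ - L ^ 2 * γ) (he : ‖e‖ ≤ δ)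
    (hu0 : u 0 = 0) (hu : ∀ n, u (n + 1) = u n - γ • (g (u n) + e)) {n : ℕ}
    (hn : ∀ k < n, τ * δ < ‖g (u k) + e‖) (hn' : ‖g (u n) + e‖ ≤ τ * δ) (w : Y) :
    B (u n) ≤ B w + (τ + 1) * √(δ ^ 2 * (2 * ‖w‖ ^ 2 + (τ ^ 2 * γ / 2) ^ 2 / (τ ^ 2 - 4)) +
      8 * B 0 / τ ^ 2 * B w) := by
  have hτ0 : 0 < τ := by linarith
  -- the condition on the step size forces `τ > 2`
  have hτ2 : 2 < τ := by
    have : 2 / τ < 1 := by nlinarith [mul_nonneg (sq_nonneg L) hγ.le]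
    rwa [div_lt_one hτ0] at this
  have hγL : γ * L ^ 2 ≤ 1 := by
    have : 0 < 2 / τ := by positivity
    nlinarith
  have hq : 0 < τ ^ 2 - 4 := by nlinarith
  have h1 := (h.add_inner e).potential_le hγ.le hγL hu0 hu w (s := (τ * δ) ^ 2) (n := n)
    fun k hk => by
      have := hn k hk
      gcongr
  have h2 : -(δ * ‖u n - w‖) ≤ inner ℝ e (u n - w) := by
    have := (abs_le.1 (abs_real_inner_le_norm e (u n - w))).1
    have : ‖e‖ * ‖u n - w‖ ≤ δ * ‖u n - w‖ := by gcongr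
    linarith
  rw [inner_sub_right] at h2
  have h3 : 2 * γ * n * -(δ * ‖u n - w‖) ≤ 2 * γ * n * (inner ℝ e (u n) - inner ℝ e w) := by
    gcongr
  have h4 : n * (γ * δ ^ 2) ≤ 2 * B 0 / τ ^ 2 := by
    rw [le_div_iff₀ (by positivity)]
    linarith [h.natCast_mul_le hB hγ hτ hδ hL he hu0 hu hn]
  have h5 : B (u n) ≤ B w + (τ + 1) * (δ * ‖u n - w‖) := by
    have := h.le (u n) w
    rw [← neg_sub (u n) w, inner_neg_right] at this
    have h6 : inner ℝ (g (u n)) (u n - w) ≤ ‖g (u n)‖ * ‖u n - w‖ := real_inner_le_norm _ _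
    have h7 : ‖g (u n)‖ ≤ (τ + 1) * δ := by
      calc ‖g (u n)‖ = ‖(g (u n) + e) - e‖ := by simp
        _ ≤ ‖g (u n) + e‖ + ‖e‖ := norm_sub_le _ _
        _ ≤ _ := by linarith
    have h8 : ‖g (u n)‖ * ‖u n - w‖ ≤ (τ + 1) * δ * ‖u n - w‖ := by gcongr
    linarith
  refine h5.trans ?_
  gcongr
  refine Real.le_sqrt_of_sq_le ?_
  set E := ‖u n - w‖
  set b := γ * n * δ with hb
  have hb0 : 0 ≤ b := by positivity
  set p := τ ^ 2 * γ / 2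
  -- completing the squares in `E` and in `b`
  have h9 : E ^ 2 ≤ 2 * ‖w‖ ^ 2 + p ^ 2 / (τ ^ 2 - 4) + 4 * γ * n * B w := by
    have h10 : E ^ 2 - 2 * b * E + τ ^ 2 / 2 * b ^ 2 - p * δ * b ≤ ‖w‖ ^ 2 + 2 * γ * n * B w := by
      have : 0 ≤ 2 * γ * n * B (u n) := by have := hB (u n); positivity
      simp only [p, hb] at *
      nlinarith
    have h11 : p * δ * b ≤ p * b := by
      have : 0 ≤ p * b := by positivity
      nlinarith
    have h12 : p * b ≤ (τ ^ 2 - 4) / 2 * b ^ 2 + p ^ 2 / (τ ^ 2 - 4) / 2 := by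
      have : 0 ≤ ((τ ^ 2 - 4) * b - p) ^ 2 / (2 * (τ ^ 2 - 4)) := by positivity
      have h13 : ((τ ^ 2 - 4) * b - p) ^ 2 / (2 * (τ ^ 2 - 4)) =
          (τ ^ 2 - 4) / 2 * b ^ 2 + p ^ 2 / (τ ^ 2 - 4) / 2 - p * b := by
        field_simp
        ring
      linarith
    nlinarith [sq_nonneg (E - 2 * b)]
  calc (δ * E) ^ 2 = δ ^ 2 * E ^ 2 := by ring
    _ ≤ δ ^ 2 * (2 * ‖w‖ ^ 2 + p ^ 2 / (τ ^ 2 - 4) + 4 * γ * n * B w) := by gcongr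
    _ = δ ^ 2 * (2 * ‖w‖ ^ 2 + p ^ 2 / (τ ^ 2 - 4)) + 4 * (n * (γ * δ ^ 2)) * B w := by ring
    _ ≤ δ ^ 2 * (2 * ‖w‖ ^ 2 + p ^ 2 / (τ ^ 2 - 4)) + 4 * (2 * B 0 / τ ^ 2) * B w := by
      have := hB w
      gcongr
    _ = _ := by ring

end SmoothConvex

end GradientDescent

/-! ### Entropy, Gibbs densities and the log-partition function -/

section Gibbs

variable {α : Type*} [MeasurableSpace α] {μ : Measure α}

theorem ae_abs_le_norm (l : Lp ℝ ∞ μ) : ∀ᵐ ω ∂μ, |l ω| ≤ ‖l‖ := by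
  filter_upwards [ae_le_eLpNormEssSup (f := (l : α → ℝ)) (μ := μ)] with ω hω
  rw [Lp.norm_def, eLpNorm_exponent_top, ← Real.norm_eq_abs, ← toReal_enorm]
  refine ENNReal.toReal_mono ?_ hω
  have := Lp.eLpNorm_ne_top l
  rwa [eLpNorm_exponent_top] at this

theorem integrable_Linfty_mul (l : Lp ℝ ∞ μ) (x : Lp ℝ 1 μ) :
    Integrable (fun ω => l ω * x ω) μ :=
  (L1.integrable_coeFn x).bdd_mul (Lp.aestronglyMeasurable l) (c := ‖l‖)
    (by simpa using ae_abs_le_norm l)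

theorem norm_eq_integral_abs (x : Lp ℝ 1 μ) : ‖x‖ = ∫ ω, |x ω| ∂μ := by
  simpa using L1.norm_eq_integral_norm x

theorem norm_of_mem_densities {x : Lp ℝ 1 μ} (hx : x ∈ densities μ) : ‖x‖ = 1 := by
  rw [norm_eq_integral_abs, ← hx.2]
  refine integral_congr_ae ?_
  filter_upwards [hx.1] with ω h using abs_of_nonneg h

/-- The entropy `∫ x log x` as a real number; it is meaningful for admissible `x`. -/
noncomputable def entropy (x : Lp ℝ 1 μ) : ℝ := ∫ ω, x ω * Real.log (x ω) ∂μ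

/-- The effective domain of the entropy functional: probability densities whose entropy is
finite. -/
def IsAdmissible (x : Lp ℝ 1 μ) : Prop :=
  x ∈ densities μ ∧ Integrable (fun ω => x ω * Real.log (x ω)) μ

theorem IsAdmissible.entropyFunctional_eq {x : Lp ℝ 1 μ} (hx : IsAdmissible x) :
    entropyFunctional x = (entropy x : EReal) := by
  have h1 : negEntropy x = (entropy x : EReal) := by
    rw [negEntropy, if_pos ⟨hx.1.1, hx.2⟩, entropy]
  rw [entropyFunctional, if_pos hx.1, h1, add_zero]

theorem isAdmissible_of_entropyFunctional_lt_top {x : Lp ℝ 1 μ} (h : entropyFunctional x < ⊤) :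
    IsAdmissible x := by
  have hbot : negEntropy x ≠ ⊥ := by
    unfold negEntropy
    split_ifs
    · exact EReal.coe_ne_bot _
    · exact bot_lt_top.ne'
  have hx : x ∈ densities μ := by
    by_contra hx
    rw [entropyFunctional, if_neg hx, EReal.add_top_of_ne_bot hbot] at h
    exact lt_irrefl _ h
  refine ⟨hx, ?_⟩
  by_contra hi
  rw [entropyFunctional, if_pos hx, negEntropy, if_neg fun h' => hi h'.2, add_zero] at h
  exact lt_irrefl _ h

variable [IsFiniteMeasure μ]

/-- `x log (x / p) - x + p ≥ (√x - √p)²`, from `log u ≤ u - 1` at `u = √(p / x)`. -/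
theorem sq_sqrt_sub_sqrt_le {x p : ℝ} (hx : 0 ≤ x) (hp : 0 < p) :
    (√x - √p) ^ 2 ≤ x * Real.log x - x * Real.log p - x + p := by
  rcases hx.eq_or_lt with rfl | hx
  · simp [Real.sq_sqrt hp.le]
  have hx' := Real.sqrt_pos.2 hx
  have hp' := Real.sqrt_pos.2 hp
  have h1 := Real.log_le_sub_one_of_pos (div_pos hp' hx')
  rw [Real.log_div hp'.ne' hx'.ne', Real.log_sqrt hx.le, Real.log_sqrt hp.le] at h1
  have h2 : x * (√p / √x) = √x * √p := by
    rw [mul_div_assoc', div_eq_iff hx'.ne']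
    nth_rewrite 1 [← Real.mul_self_sqrt hx.le]
    ring
  have h3 : x * (Real.log p / 2 - Real.log x / 2) ≤ x * (√p / √x - 1) := by gcongr
  nlinarith [Real.sq_sqrt hx.le, Real.sq_sqrt hp.le]

/-- Lower semicontinuity of the entropy in `L¹`: Fatou's lemma for `x log x + 1 ≥ 0`. -/
theorem entropy_le_of_tendsto {x : ℕ → Lp ℝ 1 μ} {z : Lp ℝ 1 μ} {c : ℝ}
    (hx : ∀ k, IsAdmissible (x k)) (hc : ∀ k, entropy (x k) ≤ c) (h : Tendsto x atTop (𝓝 z)) :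
    IsAdmissible z ∧ entropy z ≤ c := by
  obtain ⟨φ, hφ, hae⟩ := (tendstoInMeasure_of_tendsto_Lp h).exists_seq_tendsto_ae
  have hnn : ∀ᵐ ω ∂μ, 0 ≤ z ω := by
    filter_upwards [hae, ae_all_iff.2 fun k => (hx k).1.1] with ω h1 h2
    exact ge_of_tendsto' h1 fun k => h2 _
  have hz : z ∈ densities μ := by
    refine ⟨hnn, ?_⟩
    have h1 : Tendsto (fun k => ∫ ω, x k ω ∂μ) atTop (𝓝 (∫ ω, z ω ∂μ)) :=
      (continuous_integral.tendsto z).comp h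
    simp only [fun k => (hx k).1.2] at h1
    exact tendsto_nhds_unique h1 tendsto_const_nhds
  have hlow : ∀ t : ℝ, 0 ≤ t → 0 ≤ t * Real.log t + 1 := by
    intro t ht
    have := sq_sqrt_sub_sqrt_le ht one_pos
    simp only [Real.log_one, mul_zero, sub_zero] at this
    nlinarith [sq_nonneg (√t - √1)]
  have hmeas : ∀ w : Lp ℝ 1 μ, AEStronglyMeasurable (fun ω => w ω * Real.log (w ω) + 1) μ :=
    fun w => (Real.continuous_mul_log.comp_aestronglyMeasurable
      (Lp.aestronglyMeasurable w)).add aestronglyMeasurable_const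
  have hlint : ∀ k, ∫⁻ ω, ENNReal.ofReal (x k ω * Real.log (x k ω) + 1) ∂μ ≤
      ENNReal.ofReal (c + μ.real Set.univ) := by
    intro k
    have hi : Integrable (fun ω => x k ω * Real.log (x k ω) + 1) μ :=
      (hx k).2.add (integrable_const 1)
    rw [← ofReal_integral_eq_lintegral_ofReal hi]
    · refine ENNReal.ofReal_le_ofReal ?_
      rw [integral_add (hx k).2 (integrable_const 1)]
      have := hc k
      rw [entropy] at this
      simpa using this
    · filter_upwards [(hx k).1.1] with ω h using hlow _ h
  have hfatou : ∫⁻ ω, ENNReal.ofReal (z ω * Real.log (z ω) + 1) ∂μ ≤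
      ENNReal.ofReal (c + μ.real Set.univ) := by
    calc ∫⁻ ω, ENNReal.ofReal (z ω * Real.log (z ω) + 1) ∂μ
        = ∫⁻ ω, liminf (fun k => ENNReal.ofReal (x (φ k) ω * Real.log (x (φ k) ω) + 1)) atTop ∂μ
          := by
          refine lintegral_congr_ae ?_
          filter_upwards [hae] with ω h1
          refine (Tendsto.liminf_eq ?_).symm
          exact ENNReal.tendsto_ofReal
            (((Real.continuous_mul_log.tendsto _).comp h1).add tendsto_const_nhds)
      _ ≤ liminf (fun k => ∫⁻ ω, ENNReal.ofReal (x (φ k) ω * Real.log (x (φ k) ω) + 1) ∂μ)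
          atTop := lintegral_liminf_le' fun k => (hmeas _).aemeasurable.ennreal_ofReal
      _ ≤ liminf (fun _ : ℕ => ENNReal.ofReal (c + μ.real Set.univ)) atTop :=
          liminf_le_liminf (Eventually.of_forall fun k => hlint (φ k))
      _ = _ := liminf_const _
  have hnn1 : 0 ≤ᵐ[μ] fun ω => z ω * Real.log (z ω) + 1 := by
    filter_upwards [hnn] with ω h using hlow _ h
  have hint1 : Integrable (fun ω => z ω * Real.log (z ω) + 1) μ :=
    (lintegral_ofReal_ne_top_iff_integrable (hmeas z) hnn1).1
      (hfatou.trans_lt ENNReal.ofReal_lt_top).ne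
  have hint : Integrable (fun ω => z ω * Real.log (z ω)) μ := by
    exact (hint1.sub (integrable_const 1)).congr (Eventually.of_forall fun ω => by simp)
  refine ⟨⟨hz, hint⟩, ?_⟩
  have hcpos : 0 ≤ c + μ.real Set.univ := by
    have h1 : 0 ≤ ∫ ω, (x 0 ω * Real.log (x 0 ω) + 1) ∂μ := by
      refine integral_nonneg_of_ae ?_
      filter_upwards [(hx 0).1.1] with ω h using hlow _ h
    rw [integral_add (hx 0).2 (integrable_const 1)] at h1
    have h2 := hc 0
    rw [entropy] at h2
    simp only [integral_const, smul_eq_mul, mul_one] at h1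
    linarith
  rw [← ofReal_integral_eq_lintegral_ofReal hint1 hnn1,
    ENNReal.ofReal_le_ofReal_iff hcpos, integral_add hint (integrable_const 1)] at hfatou
  simpa [entropy] using hfatou

theorem integrable_exp (l : Lp ℝ ∞ μ) : Integrable (fun ω => Real.exp (l ω)) μ := by
  refine Integrable.of_bound
    (Real.continuous_exp.comp_aestronglyMeasurable (Lp.aestronglyMeasurable l))
    (Real.exp ‖l‖) ?_
  filter_upwards [ae_abs_le_norm l] with ω hω
  rw [Real.norm_eq_abs, Real.abs_exp]
  exact Real.exp_le_exp.2 ((le_abs_self _).trans hω)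

/-- The log-partition function `log ∫ e^l`, the convex conjugate of the entropy functional. -/
noncomputable def logPartition (l : Lp ℝ ∞ μ) : ℝ := Real.log (∫ ω, Real.exp (l ω) ∂μ)

/-- The Kullback-Leibler divergence `∫ x log (x / p)` of an admissible `x` from the density
`p = e^l / ∫ e^l`, expanded so that no quotient occurs. -/
noncomputable def klGibbs (x : Lp ℝ 1 μ) (l : Lp ℝ ∞ μ) : ℝ :=
  entropy x - ∫ ω, l ω * x ω ∂μ + logPartition l

variable [NeZero μ]

theorem integral_exp_Linfty_pos (l : Lp ℝ ∞ μ) : 0 < ∫ ω, Real.exp (l ω) ∂μ :=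
  integral_exp_pos (integrable_exp l)

theorem gibbs_ae_eq (l : Lp ℝ ∞ μ) :
    gibbs l =ᵐ[μ] fun ω => Real.exp (l ω - logPartition l) := by
  filter_upwards [(memLp_gibbs l).coeFn_toLp] with ω hω
  rw [Real.exp_sub, logPartition, Real.exp_log (integral_exp_Linfty_pos l), ← hω, gibbs]

theorem gibbs_mem_densities (l : Lp ℝ ∞ μ) : gibbs l ∈ densities μ := by
  constructor
  · filter_upwards [gibbs_ae_eq l] with ω hω
    rw [hω]
    positivity
  · rw [gibbs, integral_congr_ae (memLp_gibbs l).coeFn_toLp, integral_div,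
      div_self (integral_exp_Linfty_pos l).ne']

theorem gibbs_mul_log_ae_eq (l : Lp ℝ ∞ μ) :
    (fun ω => gibbs l ω * Real.log (gibbs l ω)) =ᵐ[μ]
      fun ω => l ω * gibbs l ω - logPartition l * gibbs l ω := by
  filter_upwards [gibbs_ae_eq l] with ω hω
  rw [hω, Real.log_exp]
  ring

theorem isAdmissible_gibbs (l : Lp ℝ ∞ μ) : IsAdmissible (gibbs l) :=
  ⟨gibbs_mem_densities l, ((integrable_Linfty_mul l _).sub
    ((L1.integrable_coeFn (gibbs l)).const_mul _)).congr (gibbs_mul_log_ae_eq l).symm⟩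

theorem entropy_gibbs (l : Lp ℝ ∞ μ) :
    entropy (gibbs l) = ∫ ω, l ω * gibbs l ω ∂μ - logPartition l := by
  rw [entropy, integral_congr_ae (gibbs_mul_log_ae_eq l), integral_sub (integrable_Linfty_mul l _)
    ((L1.integrable_coeFn (gibbs l)).const_mul _), integral_const_mul,
    (gibbs_mem_densities l).2, mul_one]

/-- The divergence as the integral of `x log x - x log p - x + p` with `p = gibbs l`; the terms `-x`
and `p` cancel, and they make the integrand nonnegative. -/
theorem integrable_integral_eq_klGibbs {x : Lp ℝ 1 μ} (hx : IsAdmissible x) (l : Lp ℝ ∞ μ) :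
    Integrable (fun ω => x ω * Real.log (x ω) - l ω * x ω + logPartition l * x ω - x ω
      + gibbs l ω) μ ∧
    ∫ ω, (x ω * Real.log (x ω) - l ω * x ω + logPartition l * x ω - x ω + gibbs l ω) ∂μ =
      klGibbs x l := by
  have hx1 := L1.integrable_coeFn x
  have h1 : Integrable (fun ω => x ω * Real.log (x ω) - l ω * x ω) μ :=
    hx.2.sub (integrable_Linfty_mul l x)
  have h2 : Integrable (fun ω => logPartition l * x ω) μ := hx1.const_mul _
  have h3 : Integrable (fun ω => x ω * Real.log (x ω) - l ω * x ω + logPartition l * x ω) μ :=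
    h1.add h2
  have h4 : Integrable
      (fun ω => x ω * Real.log (x ω) - l ω * x ω + logPartition l * x ω - x ω) μ := h3.sub hx1
  refine ⟨h4.add (L1.integrable_coeFn _), ?_⟩
  rw [integral_add h4 (L1.integrable_coeFn _), integral_sub h3 hx1, integral_add h1 h2,
    integral_sub hx.2 (integrable_Linfty_mul l x), integral_const_mul, hx.1.2,
    (gibbs_mem_densities l).2, klGibbs, entropy]
  ring

theorem sq_sqrt_sub_sqrt_gibbs_le {x : Lp ℝ 1 μ} (hx : IsAdmissible x) (l : Lp ℝ ∞ μ) :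
    ∀ᵐ ω ∂μ, (√(x ω) - √(gibbs l ω)) ^ 2 ≤
      x ω * Real.log (x ω) - l ω * x ω + logPartition l * x ω - x ω + gibbs l ω := by
  filter_upwards [gibbs_ae_eq l, hx.1.1] with ω h2 h3
  have h4 := sq_sqrt_sub_sqrt_le h3 (p := gibbs l ω) (by rw [h2]; positivity)
  have h5 : Real.log (gibbs l ω) = l ω - logPartition l := by rw [h2, Real.log_exp]
  rw [h5] at h4
  linarith

theorem klGibbs_nonneg {x : Lp ℝ 1 μ} (hx : IsAdmissible x) (l : Lp ℝ ∞ μ) :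
    0 ≤ klGibbs x l := by
  rw [← (integrable_integral_eq_klGibbs hx l).2]
  refine integral_nonneg_of_ae ?_
  filter_upwards [sq_sqrt_sub_sqrt_gibbs_le hx l] with ω h using (sq_nonneg _).trans h

theorem abs_sub_le_sq_sqrt_sub_sqrt {x p t : ℝ} (hx : 0 ≤ x) (hp : 0 ≤ p) (ht : 0 < t) :
    |x - p| ≤ t * (√x - √p) ^ 2 + 1 / (2 * t) * (x + p) := by
  have h7 : |x - p| = |√x - √p| * (√x + √p) := by
    rw [← abs_of_nonneg (add_nonneg (Real.sqrt_nonneg x) (Real.sqrt_nonneg p)), ← abs_mul]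
    congr 1
    nlinarith [Real.sq_sqrt hx, Real.sq_sqrt hp]
  have h8 : (√x + √p) ^ 2 ≤ 2 * (x + p) := by
    nlinarith [Real.sq_sqrt hx, Real.sq_sqrt hp, sq_nonneg (√x - √p)]
  rw [h7, ← sq_abs (√x - √p)]
  set a := |√x - √p|
  set b := √x + √p
  have h9 : 0 ≤ (2 * t * a - b) ^ 2 / (4 * t) := by positivity
  have h10 : (2 * t * a - b) ^ 2 / (4 * t) = t * a ^ 2 - a * b + 1 / (4 * t) * b ^ 2 := by
    field_simp
    ring
  have h11 : 1 / (4 * t) * b ^ 2 ≤ 1 / (4 * t) * (2 * (x + p)) := by gcongr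
  have h12 : 1 / (4 * t) * (2 * (x + p)) = 1 / (2 * t) * (x + p) := by
    field_simp
    ring
  linarith

/-- An inequality of Pinsker type. It follows from
`x log (x / p) - x + p ≥ (√x - √p)²` and `|x - p| ≤ t (√x - √p)² + (x + p) / (2 t)`, with the best
choice of `t`. -/
theorem norm_sub_gibbs_sq_le {x : Lp ℝ 1 μ} (hx : IsAdmissible x) (l : Lp ℝ ∞ μ) :
    ‖x - gibbs l‖ ^ 2 ≤ 4 * klGibbs x l := by
  set N := ‖x - gibbs l‖ with hN
  have hsum : Integrable (fun ω => x ω + gibbs l ω) μ :=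
    (L1.integrable_coeFn x).add (L1.integrable_coeFn (gibbs l))
  obtain ⟨hint, hkl⟩ := integrable_integral_eq_klGibbs hx l
  have key : ∀ t : ℝ, 0 < t → N ≤ t * klGibbs x l + 1 / t := by
    intro t ht
    calc N = ∫ ω, |(x - gibbs l : Lp ℝ 1 μ) ω| ∂μ := norm_eq_integral_abs _
      _ ≤ ∫ ω, (t * (x ω * Real.log (x ω) - l ω * x ω + logPartition l * x ω - x ω + gibbs l ω)
            + 1 / (2 * t) * (x ω + gibbs l ω)) ∂μ := by
          refine integral_mono_ae (L1.integrable_coeFn (x - gibbs l)).abs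
            ((hint.const_mul t).add (hsum.const_mul (1 / (2 * t)))) ?_
          filter_upwards [Lp.coeFn_sub x (gibbs l), (gibbs_mem_densities l).1, hx.1.1,
            sq_sqrt_sub_sqrt_gibbs_le hx l] with ω h1 h2 h3 h4
          rw [h1, Pi.sub_apply]
          refine (abs_sub_le_sq_sqrt_sub_sqrt h3 h2 ht).trans ?_
          gcongr
      _ = t * klGibbs x l + 1 / (2 * t) * (1 + 1) := by
          rw [integral_add (hint.const_mul t) (hsum.const_mul (1 / (2 * t))), integral_const_mul,
            integral_const_mul, hkl,
            integral_add (L1.integrable_coeFn x) (L1.integrable_coeFn (gibbs l)), hx.1.2,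
            (gibbs_mem_densities l).2]
      _ = _ := by
          field_simp
          ring
  have hN0 : 0 ≤ N := norm_nonneg _
  rcases hN0.eq_or_lt with h0 | h0
  · rw [← h0]
    linarith [klGibbs_nonneg hx l]
  · have h1 := key (2 / N) (by positivity)
    have h2 : 2 / N * klGibbs x l + 1 / (2 / N) = 2 / N * klGibbs x l + N / 2 := by
      field_simp
    have h3 : N / 2 ≤ 2 / N * klGibbs x l := by linarith
    rw [div_mul_eq_mul_div, le_div_iff₀ h0] at h3
    linarith

/-- The log-partition function is strongly smooth with respect to the `L^∞` norm, with gradient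
`gibbs l`. This is Hoeffding's lemma for the random variable `m - l` under the law of density
`gibbs l`. -/
theorem logPartition_le (l m : Lp ℝ ∞ μ) {c : ℝ} (hc : ∀ᵐ ω ∂μ, |m ω - l ω| ≤ c) :
    logPartition m ≤ logPartition l + (∫ ω, m ω * gibbs l ω ∂μ - ∫ ω, l ω * gibbs l ω ∂μ)
      + c ^ 2 / 2 := by
  set ν := μ.tilted l
  have : IsProbabilityMeasure ν := isProbabilityMeasure_tilted (integrable_exp l)
  have hac : ν ≪ μ := tilted_absolutelyContinuous μ l
  have hm : AEMeasurable (fun ω => m ω - l ω) ν :=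
    ((Lp.aestronglyMeasurable m).sub (Lp.aestronglyMeasurable l)).aemeasurable.mono_ac hac
  have hc' : ∀ᵐ ω ∂ν, m ω - l ω ∈ Set.Icc (-c) c := by
    filter_upwards [hac.ae_le hc] with ω h using abs_le.1 h
  have hmean : ∫ ω, (m ω - l ω) ∂ν = ∫ ω, m ω * gibbs l ω ∂μ - ∫ ω, l ω * gibbs l ω ∂μ := by
    rw [integral_tilted, ← integral_sub (integrable_Linfty_mul m _) (integrable_Linfty_mul l _)]
    refine integral_congr_ae ?_
    filter_upwards [(memLp_gibbs l).coeFn_toLp] with ω h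
    rw [gibbs, h, smul_eq_mul]
    ring
  have hexp : ∫ ω, Real.exp (m ω - l ω) ∂ν = Real.exp (logPartition m - logPartition l) := by
    rw [integral_exp_tilted, Real.exp_sub, logPartition, logPartition,
      Real.exp_log (integral_exp_Linfty_pos l), Real.exp_log (integral_exp_Linfty_pos m)]
    simp
  have h := (ProbabilityTheory.hasSubgaussianMGF_of_mem_Icc hm hc').mgf_le 1
  rw [hmean] at h
  simp only [ProbabilityTheory.mgf, one_mul] at h
  simp only [Real.exp_sub _ (_ - _)] at h
  rw [integral_div, hexp, ← Real.exp_sub, Real.exp_le_exp] at h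
  have h1 : (((‖c - -c‖₊ / 2) ^ 2 : NNReal) : ℝ) = c ^ 2 := by
    push_cast
    rw [Real.norm_eq_abs, div_pow, sq_abs]
    ring
  rw [h1] at h
  linarith

end Gibbs

/-! ### The adjoint -/

section Adjoint

variable {α : Type*} [MeasurableSpace α] {μ : Measure α} [IsFiniteMeasure μ]
variable {Y : Type*} [NormedAddCommGroup Y] [InnerProductSpace ℝ Y]

theorem adj_sub (A : Lp ℝ 1 μ →L[ℝ] Y) (v w : Y) : adj A (v - w) = adj A v - adj A w := by
  refine (adj_unique A _ _ fun x => ?_).symm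
  rw [inner_sub_left, ← adj_spec, ← adj_spec,
    ← integral_sub (integrable_Linfty_mul _ _) (integrable_Linfty_mul _ _)]
  refine integral_congr_ae ?_
  filter_upwards [Lp.coeFn_sub (adj A v) (adj A w)] with ω h
  rw [h, Pi.sub_apply, sub_mul]

/-- The bound `‖A^* v‖_∞ ≤ ‖A‖ ‖v‖`, in pointwise form. -/
theorem ae_abs_adj_le (A : Lp ℝ 1 μ →L[ℝ] Y) (v : Y) : ∀ᵐ ω ∂μ, |adj A v ω| ≤ ‖A‖ * ‖v‖ := by
  have hg : Integrable (adj A v) μ := (Lp.memLp (adj A v)).integrable le_top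
  have habs : ∀ s : Set α, MeasurableSet s →
      |∫ ω in s, adj A v ω ∂μ| ≤ ‖A‖ * ‖v‖ * μ.real s := by
    intro s hs
    have h1 : ∫ ω in s, adj A v ω ∂μ =
        inner ℝ v (A (indicatorConstLp 1 hs (measure_ne_top μ s) (1 : ℝ))) := by
      rw [← adj_spec, ← integral_indicator hs]
      refine integral_congr_ae ?_
      filter_upwards [indicatorConstLp_coeFn (p := 1) (hs := hs)
        (hμs := measure_ne_top μ s) (c := (1 : ℝ))] with ω a
      rw [a]
      by_cases h : ω ∈ s <;> simp [h]
    rw [h1]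
    calc _ ≤ ‖v‖ * ‖A (indicatorConstLp 1 hs (measure_ne_top μ s) (1 : ℝ))‖ :=
          abs_real_inner_le_norm _ _
      _ ≤ ‖v‖ * (‖A‖ * μ.real s) := by
          gcongr
          refine (A.le_opNorm _).trans ?_
          gcongr
          exact norm_indicatorConstLp_le.trans (by simp)
      _ = _ := by ring
  have hub : adj A v ≤ᵐ[μ] fun _ => ‖A‖ * ‖v‖ := by
    refine ae_le_of_forall_setIntegral_le hg (integrable_const _) fun s hs _ => ?_
    simpa [mul_comm] using (le_abs_self _).trans (habs s hs)
  have hlb : (fun _ => -(‖A‖ * ‖v‖)) ≤ᵐ[μ] adj A v := by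
    refine ae_le_of_forall_setIntegral_le (integrable_const _) hg fun s hs _ => ?_
    simpa [mul_comm] using (abs_le.1 (habs s hs)).1
  filter_upwards [hub, hlb] with ω h1 h2 using abs_le.2 ⟨h2, h1⟩

end Adjoint

/-! ### Duality for entropy minimization -/

section Duality

variable {α : Type*} [MeasurableSpace α] {μ : Measure α} [IsFiniteMeasure μ]
variable {Y : Type*} [NormedAddCommGroup Y] [InnerProductSpace ℝ Y]

theorem klGibbs_adj (A : Lp ℝ 1 μ →L[ℝ] Y) (x : Lp ℝ 1 μ) (v : Y) :
    klGibbs x (adj A v) = entropy x - inner ℝ v (A x) + logPartition (adj A v) := by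
  rw [klGibbs, adj_spec]

theorem neZero_of_mem_densities {x : Lp ℝ 1 μ} (hx : x ∈ densities μ) : NeZero μ := by
  refine ⟨?_⟩
  rintro rfl
  simpa using hx.2

/-- Under the source condition `x` is itself a density `e^l / ∫ e^l` with `l = A^* v`: the dual
problem has a solution. -/
theorem SourceCondition.exists_klGibbs_eq_zero {A : Lp ℝ 1 μ →L[ℝ] Y} {x : Lp ℝ 1 μ}
    (hx : x ∈ densities μ) (h : SourceCondition A x) : ∃ v, klGibbs x (adj A v) = 0 := by
  obtain ⟨v, hv⟩ := h
  refine ⟨v, ?_⟩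
  have h1 : entropy x = ∫ ω, adj A v ω * x ω ∂μ - 1 := by
    rw [entropy, ← hx.2, ← integral_sub (integrable_Linfty_mul _ _) (L1.integrable_coeFn x)]
    refine integral_congr_ae ?_
    filter_upwards [hv] with ω hω
    rw [← hω.2]
    ring
  have h2 : logPartition (adj A v) = 1 := by
    have : ∫ ω, Real.exp (adj A v ω) ∂μ = ∫ ω, Real.exp 1 * x ω ∂μ := by
      refine integral_congr_ae ?_
      filter_upwards [hv] with ω hω
      rw [← hω.2, Real.exp_add, Real.exp_log hω.1]
    rw [logPartition, this, integral_const_mul, hx.2, mul_one, Real.log_exp]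
  rw [klGibbs, h1, h2]
  ring

variable [NeZero μ]

/-- The Bregman distance of the dual objective `v ↦ klGibbs z (adj A v)` dominates the squared
distance of the associated densities; in particular the dual objective is convex. -/
theorem norm_gibbs_sub_gibbs_sq_le (A : Lp ℝ 1 μ →L[ℝ] Y) (z : Lp ℝ 1 μ) (v w : Y) :
    ‖gibbs (adj A v) - gibbs (adj A w)‖ ^ 2 ≤
      4 * (klGibbs z (adj A w) - klGibbs z (adj A v) -
        inner ℝ (A (gibbs (adj A v)) - A z) (w - v)) := by
  refine (norm_sub_gibbs_sq_le (isAdmissible_gibbs (adj A v)) (adj A w)).trans_eq ?_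
  rw [klGibbs_adj, klGibbs_adj, klGibbs_adj, entropy_gibbs, adj_spec, real_inner_comm (w - v)]
  simp only [inner_sub_left, inner_sub_right]
  ring

theorem smoothConvex_klGibbs (A : Lp ℝ 1 μ →L[ℝ] Y) (z : Lp ℝ 1 μ) :
    SmoothConvex (fun v => klGibbs z (adj A v)) (fun v => A (gibbs (adj A v)) - A z) ‖A‖ where
  le v w := by
    have := (sq_nonneg _).trans (norm_gibbs_sub_gibbs_sq_le A z v w)
    linarith
  ge v w := by
    have h1 := logPartition_le (adj A v) (adj A w) (c := ‖A‖ * ‖w - v‖) (by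
      filter_upwards [ae_abs_adj_le A (w - v), Lp.coeFn_sub (adj A w) (adj A v)] with ω h2 h3
      rwa [adj_sub, h3, Pi.sub_apply] at h2)
    rw [adj_spec, adj_spec, mul_pow] at h1
    rw [klGibbs_adj, klGibbs_adj, real_inner_comm (w - v)]
    simp only [inner_sub_left, inner_sub_right]
    linarith

/-- Strong duality, without a compactness argument. Densities belonging to a minimizing sequence of
the dual objective form a Cauchy sequence in `L¹`, because the Bregman distances to the midpoints
control their distances. Their limit is feasible because the gradients of the dual objective tend
to zero. A minimizing sequence with `⟨∇, v⟩ ≤ 0` gives the bound on the entropy of the limit. -/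
theorem exists_primal_optimal (A : Lp ℝ 1 μ →L[ℝ] Y) {z : Lp ℝ 1 μ} (hz : IsAdmissible z) :
    ∃ x, IsAdmissible x ∧ A x = A z ∧ ∀ ε > 0, ∃ v, klGibbs x (adj A v) ≤ ε := by
  have hs := smoothConvex_klGibbs A z
  set B : Y → ℝ := fun v => klGibbs z (adj A v) with hB
  set m := ⨅ v, B v with hm
  have hmle : ∀ v, m ≤ B v := fun v =>
    ciInf_le ⟨0, by rintro _ ⟨v, rfl⟩; exact klGibbs_nonneg hz _⟩ v
  have hex : ∀ k : ℕ, ∃ w, B w ≤ m + 1 / ((k : ℝ) + 1) ∧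
      inner ℝ (A (gibbs (adj A w)) - A z) w ≤ 0 := by
    intro k
    obtain ⟨v, hv⟩ := exists_lt_of_ciInf_lt (f := B) (a := m + 1 / ((k : ℝ) + 1))
      (by rw [← hm]; linarith [Nat.one_div_pos_of_nat (α := ℝ) (n := k)])
    obtain ⟨w, hw, hw'⟩ := hs.exists_le_inner_nonpos v
    exact ⟨w, hw.trans hv.le, hw'⟩
  choose w hw hw' using hex
  set x : ℕ → Lp ℝ 1 μ := fun k => gibbs (adj A (w k)) with hx
  have hdist : ∀ j k, ‖x j - x k‖ ^ 2 ≤ 8 * ((B (w j) - m) + (B (w k) - m)) := by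
    intro j k
    set c := (1 / 2 : ℝ) • (w j + w k) with hc
    have h1 := norm_gibbs_sub_gibbs_sq_le A z c (w j)
    have h2 := norm_gibbs_sub_gibbs_sq_le A z c (w k)
    have h3 : w k - c = -(w j - c) := by
      rw [hc]
      module
    rw [h3, inner_neg_right] at h2
    have h4 : ‖x j - x k‖ ≤ ‖gibbs (adj A c) - x j‖ + ‖gibbs (adj A c) - x k‖ := by
      rw [norm_sub_rev (gibbs (adj A c)) (x j)]
      exact norm_sub_le_norm_sub_add_norm_sub _ _ _
    have h5 := hmle c
    have h6 : ‖x j - x k‖ ^ 2 ≤ (‖gibbs (adj A c) - x j‖ + ‖gibbs (adj A c) - x k‖) ^ 2 := by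
      gcongr
    simp only [hB, hx] at *
    nlinarith [sq_nonneg (‖gibbs (adj A c) - gibbs (adj A (w j))‖ -
      ‖gibbs (adj A c) - gibbs (adj A (w k))‖)]
  have hcauchy : CauchySeq x := by
    refine cauchySeq_of_le_tendsto_0 (fun N : ℕ => √(16 * (1 / ((N : ℝ) + 1)))) ?_ ?_
    · intro j k N hj hk
      rw [dist_eq_norm]
      refine Real.le_sqrt_of_sq_le ((hdist j k).trans ?_)
      have h1 := Nat.one_div_le_one_div (α := ℝ) hj
      have h2 := Nat.one_div_le_one_div (α := ℝ) hk
      linarith [hw j, hw k]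
    · have := (tendsto_one_div_add_atTop_nhds_zero_nat (𝕜 := ℝ)).const_mul 16
      simpa using this.sqrt
  obtain ⟨xs, hxs⟩ := cauchySeq_tendsto_of_complete hcauchy
  have hent : ∀ k, entropy (x k) = inner ℝ (A (x k) - A z) (w k) + entropy z - B (w k) := by
    intro k
    simp only [hB, hx]
    rw [klGibbs_adj, entropy_gibbs, adj_spec, inner_sub_left, real_inner_comm _ (w k),
      real_inner_comm _ (w k)]
    ring
  obtain ⟨hadm, hle⟩ := entropy_le_of_tendsto (c := entropy z - m)
    (fun k => isAdmissible_gibbs (adj A (w k)))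
    (fun k => by
      have h1 := hent k
      have h2 := hw' k
      have h3 := hmle (w k)
      simp only [hx] at *
      linarith) hxs
  have hfeas : A xs = A z := by
    have h1 : Tendsto (fun k => A (x k) - A z) atTop (𝓝 (A xs - A z)) :=
      ((A.continuous.tendsto xs).comp hxs).sub_const _
    have h2 : Tendsto (fun k => A (x k) - A z) atTop (𝓝 0) := by
      refine squeeze_zero_norm
        (a := fun k : ℕ => √(2 * (‖A‖ ^ 2 + 1) * (1 / ((k : ℝ) + 1)))) (fun k => ?_) ?_
      · refine Real.le_sqrt_of_sq_le ((hs.norm_gradient_sq_le hmle (w k)).trans ?_)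
        have := hw k
        gcongr
        linarith
      · have := (tendsto_one_div_add_atTop_nhds_zero_nat (𝕜 := ℝ)).const_mul (2 * (‖A‖ ^ 2 + 1))
        simpa using this.sqrt
    exact sub_eq_zero.1 (tendsto_nhds_unique h1 h2)
  refine ⟨xs, hadm, hfeas, fun ε hε => ?_⟩
  obtain ⟨k, hk⟩ := exists_nat_one_div_lt hε
  refine ⟨w k, ?_⟩
  have h1 := hw k
  simp only [hB] at h1
  rw [klGibbs_adj] at h1 ⊢
  rw [hfeas]
  linarith

/-- Every solution has finite entropy, and for every solution the duality gap vanishes. -/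
theorem IsEntropySolution.spec {A : Lp ℝ 1 μ →L[ℝ] Y} {y : Y} {z x : Lp ℝ 1 μ}
    (hz : IsAdmissible z) (hzy : A z = y) (hx : IsEntropySolution A y x) :
    IsAdmissible x ∧ ∀ ε > 0, ∃ v, klGibbs x (adj A v) ≤ ε := by
  obtain ⟨s, hs, hsy, hsε⟩ := exists_primal_optimal A hz
  have h1 := hx.2 s (hsy.trans hzy)
  rw [hs.entropyFunctional_eq] at h1
  have hadm := isAdmissible_of_entropyFunctional_lt_top (h1.trans_lt (EReal.coe_lt_top _))
  rw [hadm.entropyFunctional_eq, EReal.coe_le_coe_iff] at h1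
  refine ⟨hadm, fun ε hε => ?_⟩
  obtain ⟨v, hv⟩ := hsε ε hε
  refine ⟨v, ?_⟩
  rw [klGibbs_adj] at hv ⊢
  rw [hx.1, ← hzy, ← hsy]
  linarith

theorem existsUnique_isEntropySolution {A : Lp ℝ 1 μ →L[ℝ] Y} {y : Y} {z : Lp ℝ 1 μ}
    (hz : IsAdmissible z) (hzy : A z = y) : ∃! x, IsEntropySolution A y x := by
  obtain ⟨s, hs, hsy, hsε⟩ := exists_primal_optimal A hz
  have hsol : IsEntropySolution A y s := by
    refine ⟨hsy.trans hzy, fun x hx => ?_⟩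
    by_cases hfin : entropyFunctional x < ⊤
    · have hadm := isAdmissible_of_entropyFunctional_lt_top hfin
      rw [hs.entropyFunctional_eq, hadm.entropyFunctional_eq, EReal.coe_le_coe_iff]
      refine le_of_forall_pos_le_add fun ε hε => ?_
      obtain ⟨v, hv⟩ := hsε ε hε
      have h1 := klGibbs_nonneg hadm (adj A v)
      rw [klGibbs_adj] at h1 hv
      rw [hx, ← hzy, ← hsy] at h1
      linarith
    · rw [not_lt_top_iff.1 hfin]
      exact le_top
  refine ⟨s, hsol, fun x hx => ?_⟩
  have hadm := (hx.spec hz hzy).1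
  have hle := hx.2 s hsol.1
  rw [hs.entropyFunctional_eq, hadm.entropyFunctional_eq, EReal.coe_le_coe_iff] at hle
  by_contra hne
  -- a density close to `s` in the Kullback-Leibler sense is just as close to `x`
  have hN : 0 < ‖x - s‖ := norm_pos_iff.2 (sub_ne_zero.2 hne)
  obtain ⟨v, hv⟩ := hsε ((‖x - s‖ / 8) ^ 2) (by positivity)
  have hv' : klGibbs x (adj A v) ≤ (‖x - s‖ / 8) ^ 2 := by
    rw [klGibbs_adj] at hv ⊢
    rw [hx.1, ← hsol.1]
    linarith
  have hclose : ∀ {q : Lp ℝ 1 μ}, IsAdmissible q → klGibbs q (adj A v) ≤ (‖x - s‖ / 8) ^ 2 →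
      ‖q - gibbs (adj A v)‖ ≤ ‖x - s‖ / 4 := by
    intro q hq hqv
    refine le_of_sq_le_sq ?_ (by positivity)
    linarith [norm_sub_gibbs_sq_le hq (adj A v)]
  have h1 := hclose hadm hv'
  have h2 := hclose hs hv
  rw [norm_sub_rev] at h2
  linarith [norm_sub_le_norm_sub_add_norm_sub x (gibbs (adj A v)) s]

end Duality

/-! ### Convergence of the entropic dual gradient method -/

section Convergence

variable {α : Type*} [MeasurableSpace α] {μ : Measure α} [IsFiniteMeasure μ]
variable {Y : Type*} [NormedAddCommGroup Y] [InnerProductSpace ℝ Y]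
variable {A : Lp ℝ 1 μ →L[ℝ] Y} {x : Lp ℝ 1 μ} {γ τ δ : ℝ} {yd : Y}

theorem dualIterate_succ (x : Lp ℝ 1 μ) (n : ℕ) :
    dualIterate A γ yd (n + 1) = dualIterate A γ yd n -
      γ • (A (gibbs (adj A (dualIterate A γ yd n))) - A x + (A x - yd)) := by
  rw [dualIterate, sub_add_sub_cancel]

variable [NeZero μ]

theorem norm_primalIterate_sub_le (hx : IsAdmissible x) (n : ℕ) {c : ℝ}
    (h : klGibbs x (adj A (dualIterate A γ yd n)) ≤ c) :
    ‖primalIterate A γ yd n - x‖ ≤ √(4 * c) := by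
  rw [norm_sub_rev]
  exact Real.le_sqrt_of_sq_le ((norm_sub_gibbs_sq_le hx _).trans (by linarith))

theorem klGibbs_dualIterate_le (hγ : 0 < γ) (hA : γ * ‖A‖ ^ 2 ≤ 1)
    (hyd : ‖yd - A x‖ ≤ δ) (v : Y) {n : ℕ} (hn : 0 < n) :
    klGibbs x (adj A (dualIterate A γ yd n)) ≤
      klGibbs x (adj A v) + (‖v‖ ^ 2 / (2 * γ) * (n : ℝ)⁻¹ + γ / 2 * (δ ^ 2 * n)) := by
  rw [norm_sub_rev] at hyd
  have h := (smoothConvex_klGibbs A x).error_le hγ.le hA (u := dualIterate A γ yd)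
    (by rw [dualIterate]) (dualIterate_succ x) hyd v n
  have hn' : (0 : ℝ) < n := Nat.cast_pos.2 hn
  have h1 : klGibbs x (adj A (dualIterate A γ yd n)) - klGibbs x (adj A v) ≤
      (‖v‖ ^ 2 + (γ * n * δ) ^ 2) / (2 * γ * n) := by
    rw [le_div_iff₀ (by positivity)]
    linarith
  have h2 : (‖v‖ ^ 2 + (γ * n * δ) ^ 2) / (2 * γ * n) =
      ‖v‖ ^ 2 / (2 * γ) * (n : ℝ)⁻¹ + γ / 2 * (δ ^ 2 * n) := by
    field_simp
  linarith

theorem tendsto_primalIterate_of_klGibbs (hx : IsAdmissible x) {yd : ℝ → Y} {n : ℝ → ℕ}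
    (h : ∀ ε > 0, ∀ᶠ δ in 𝓝[>] (0 : ℝ),
      klGibbs x (adj A (dualIterate A γ (yd δ) (n δ))) < ε) :
    Tendsto (fun δ => ‖primalIterate A γ (yd δ) (n δ) - x‖) (𝓝[>] 0) (𝓝 0) := by
  have h1 : Tendsto (fun δ => klGibbs x (adj A (dualIterate A γ (yd δ) (n δ)))) (𝓝[>] 0) (𝓝 0) :=
    tendsto_order.2 ⟨fun a ha => Eventually.of_forall fun δ => ha.trans_le (klGibbs_nonneg hx _), h⟩
  refine squeeze_zero (fun _ => norm_nonneg _) (fun δ => norm_primalIterate_sub_le hx _ le_rfl) ?_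
  simpa using (h1.const_mul 4).sqrt

theorem tendsto_primalIterate_apriori (hx : IsAdmissible x)
    (hdual : ∀ ε > 0, ∃ v, klGibbs x (adj A v) ≤ ε) (hγ : 0 < γ) (hA : γ * ‖A‖ ^ 2 ≤ 1)
    {yd : ℝ → Y} {n : ℝ → ℕ} (hyd : ∀ δ > 0, ‖yd δ - A x‖ ≤ δ) (hn : Tendsto n (𝓝[>] 0) atTop)
    (hn' : Tendsto (fun δ : ℝ => δ ^ 2 * (n δ : ℝ)) (𝓝[>] 0) (𝓝 0)) :
    Tendsto (fun δ => ‖primalIterate A γ (yd δ) (n δ) - x‖) (𝓝[>] 0) (𝓝 0) := by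
  refine tendsto_primalIterate_of_klGibbs hx fun ε hε => ?_
  obtain ⟨v, hv⟩ := hdual (ε / 2) (half_pos hε)
  have h1 : Tendsto (fun δ => ‖v‖ ^ 2 / (2 * γ) * (n δ : ℝ)⁻¹ + γ / 2 * (δ ^ 2 * n δ))
      (𝓝[>] 0) (𝓝 0) := by
    simpa using ((tendsto_inv_atTop_zero.comp
      (tendsto_natCast_atTop_atTop.comp hn)).const_mul (‖v‖ ^ 2 / (2 * γ))).add
      (hn'.const_mul (γ / 2))
  filter_upwards [h1.eventually_lt_const (half_pos hε), hn.eventually_gt_atTop 0,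
    self_mem_nhdsWithin] with δ h2 h3 h4
  linarith [klGibbs_dualIterate_le hγ hA (hyd δ h4) v h3]

theorem norm_primalIterate_sub_le_apriori (hx : IsAdmissible x) {v : Y}
    (hv : klGibbs x (adj A v) = 0) (hγ : 0 < γ) (hA : γ * ‖A‖ ^ 2 ≤ 1) {c₁ c₂ : ℝ} (hc₁ : 0 < c₁)
    (hδ : 0 < δ) (hyd : ‖yd - A x‖ ≤ δ) {n : ℕ} (h₁ : c₁ * δ⁻¹ ≤ n) (h₂ : n ≤ c₂ * δ⁻¹) :
    ‖primalIterate A γ yd n - x‖ ≤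
      √(4 * (‖v‖ ^ 2 / (2 * γ) * c₁⁻¹ + γ / 2 * c₂)) * δ ^ (1 / 2 : ℝ) := by
  have hn : (0 : ℝ) < n := lt_of_lt_of_le (by positivity) h₁
  have h3 := klGibbs_dualIterate_le hγ hA hyd v (Nat.cast_pos.1 hn)
  rw [← Real.sqrt_eq_rpow, ← Real.sqrt_mul' _ hδ.le, mul_assoc]
  refine norm_primalIterate_sub_le hx n (h3.trans ?_)
  rw [hv, zero_add, add_mul, mul_assoc, mul_assoc (γ / 2)]
  have h4 : (n : ℝ)⁻¹ ≤ c₁⁻¹ * δ := by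
    calc (n : ℝ)⁻¹ ≤ (c₁ * δ⁻¹)⁻¹ := by gcongr
      _ = c₁⁻¹ * δ := by rw [mul_inv, inv_inv]
  have h5 : δ ^ 2 * (n : ℝ) ≤ c₂ * δ := by
    calc δ ^ 2 * (n : ℝ) ≤ δ ^ 2 * (c₂ * δ⁻¹) := by gcongr
      _ = c₂ * δ := by field_simp
  exact add_le_add (mul_le_mul_of_nonneg_left h4 (by positivity))
    (mul_le_mul_of_nonneg_left h5 (by positivity))

theorem existsUnique_isDiscrepancyIndex (hx : IsAdmissible x) (hτ : 1 < τ) (hγ : 0 < γ)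
    (hA : 0 < 1 - 2 / τ - ‖A‖ ^ 2 * γ) (hδ : 0 < δ) (hyd : ‖yd - A x‖ ≤ δ) :
    ∃! n, IsDiscrepancyIndex A γ τ δ yd n := by
  classical
  rw [norm_sub_rev] at hyd
  have hex : ∃ n, ‖A (primalIterate A γ yd n) - yd‖ ≤ τ * δ := by
    obtain ⟨n, hn⟩ := (smoothConvex_klGibbs A x).exists_residual_le
      (fun v => klGibbs_nonneg hx _) hγ hτ hδ hA hyd (u := dualIterate A γ yd)
      (by rw [dualIterate]) (dualIterate_succ x)
    rw [sub_add_sub_cancel] at hn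
    exact ⟨n, hn⟩
  refine ⟨Nat.find hex, ⟨Nat.find_spec hex, fun m hm => not_le.1 (Nat.find_min hex hm)⟩, ?_⟩
  intro n hn
  exact ((Nat.find_eq_iff hex).2 ⟨hn.1, fun m hm => not_le.2 (hn.2 m hm)⟩).symm

theorem klGibbs_dualIterate_le_of_discrepancy (hx : IsAdmissible x) (hτ : 1 < τ) (hγ : 0 < γ)
    (hA : 0 < 1 - 2 / τ - ‖A‖ ^ 2 * γ) (hδ : 0 < δ) (hδ1 : δ ≤ 1) (hyd : ‖yd - A x‖ ≤ δ) {n : ℕ}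
    (hn : IsDiscrepancyIndex A γ τ δ yd n) (v : Y) :
    klGibbs x (adj A (dualIterate A γ yd n)) ≤ klGibbs x (adj A v) +
      (τ + 1) * √(δ ^ 2 * (2 * ‖v‖ ^ 2 + (τ ^ 2 * γ / 2) ^ 2 / (τ ^ 2 - 4)) +
        8 * klGibbs x (adj A 0) / τ ^ 2 * klGibbs x (adj A v)) := by
  rw [norm_sub_rev] at hyd
  refine (smoothConvex_klGibbs A x).error_le_of_discrepancy (fun v => klGibbs_nonneg hx _) hγ hτ
    hδ hδ1 hA hyd (u := dualIterate A γ yd) (by rw [dualIterate]) (dualIterate_succ x)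
    (fun k hk => ?_) ?_ v
  · rw [sub_add_sub_cancel]
    exact hn.2 k hk
  · rw [sub_add_sub_cancel]
    exact hn.1

theorem tendsto_primalIterate_discrepancy (hx : IsAdmissible x)
    (hdual : ∀ ε > 0, ∃ v, klGibbs x (adj A v) ≤ ε) (hτ : 1 < τ) (hγ : 0 < γ)
    (hA : 0 < 1 - 2 / τ - ‖A‖ ^ 2 * γ) {yd : ℝ → Y} {n : ℝ → ℕ}
    (hyd : ∀ δ > 0, ‖yd δ - A x‖ ≤ δ)
    (hn : ∀ δ > 0, IsDiscrepancyIndex A γ τ δ (yd δ) (n δ)) :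
    Tendsto (fun δ => ‖primalIterate A γ (yd δ) (n δ) - x‖) (𝓝[>] 0) (𝓝 0) := by
  refine tendsto_primalIterate_of_klGibbs hx fun ε hε => ?_
  set c := 8 * klGibbs x (adj A 0) / τ ^ 2 with hc
  have hc0 : 0 ≤ c := by have := klGibbs_nonneg hx (adj A 0); positivity
  have hτ0 : 0 ≤ τ + 1 := by linarith
  obtain ⟨η, hηε, hη⟩ : ∃ η : ℝ, η + (τ + 1) * √(c * η) < ε ∧ 0 < η := by
    have h1 : Tendsto (fun η : ℝ => η + (τ + 1) * √(c * η)) (𝓝[>] 0) (𝓝 0) :=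
      (Continuous.tendsto' (by fun_prop) _ _ (by simp)).mono_left nhdsWithin_le_nhds
    exact ((h1.eventually_lt_const hε).and self_mem_nhdsWithin).exists
  obtain ⟨v, hv⟩ := hdual η hη
  set K := 2 * ‖v‖ ^ 2 + (τ ^ 2 * γ / 2) ^ 2 / (τ ^ 2 - 4)
  have h2 : Tendsto (fun δ : ℝ => η + (τ + 1) * √(δ ^ 2 * K + c * η)) (𝓝[>] 0)
      (𝓝 (η + (τ + 1) * √(c * η))) :=
    (Continuous.tendsto' (by fun_prop) _ _ (by simp)).mono_left nhdsWithin_le_nhds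
  filter_upwards [h2.eventually_lt_const hηε, self_mem_nhdsWithin,
    nhdsWithin_le_nhds (eventually_le_nhds (zero_lt_one' ℝ))] with δ h3 h4 h5
  refine lt_of_le_of_lt ((klGibbs_dualIterate_le_of_discrepancy hx hτ hγ hA h4 h5 (hyd δ h4)
    (hn δ h4) v).trans ?_) h3
  gcongr

theorem norm_primalIterate_sub_le_discrepancy (hx : IsAdmissible x) {v : Y}
    (hv : klGibbs x (adj A v) = 0) (hτ : 1 < τ) (hγ : 0 < γ)
    (hA : 0 < 1 - 2 / τ - ‖A‖ ^ 2 * γ) (hδ : 0 < δ) (hyd : ‖yd - A x‖ ≤ δ) {n : ℕ}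
    (hn : IsDiscrepancyIndex A γ τ δ yd n) :
    ‖primalIterate A γ yd n - x‖ ≤ max 2
      (√(4 * ((τ + 1) * √(2 * ‖v‖ ^ 2 + (τ ^ 2 * γ / 2) ^ 2 / (τ ^ 2 - 4))))) *
        δ ^ (1 / 2 : ℝ) := by
  rw [← Real.sqrt_eq_rpow]
  rcases le_total δ 1 with h1 | h1
  · have h2 := klGibbs_dualIterate_le_of_discrepancy hx hτ hγ hA hδ h1 hyd hn v
    rw [hv, zero_add, mul_zero, add_zero, Real.sqrt_mul (sq_nonneg δ), Real.sqrt_sq hδ.le] at h2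
    refine (norm_primalIterate_sub_le hx n h2).trans ?_
    refine le_trans (le_of_eq ?_) (mul_le_mul_of_nonneg_right (le_max_right _ _)
      (Real.sqrt_nonneg δ))
    rw [← Real.sqrt_mul' _ hδ.le]
    congr 1
    ring
  -- for large `δ` the distance of two densities, at most `2`, is already small enough
  · calc ‖primalIterate A γ yd n - x‖ ≤ ‖primalIterate A γ yd n‖ + ‖x‖ := norm_sub_le _ _
      _ = 2 * 1 := by
        rw [primalIterate, norm_of_mem_densities (gibbs_mem_densities _),
          norm_of_mem_densities hx.1]
        norm_num
      _ ≤ _ := by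
        gcongr
        · exact le_max_left _ _
        · exact Real.one_le_sqrt.2 h1

end Convergence

end EntropicDual

theorem corollary4p3 {d : ℕ} (Ω : EntropicDual.BoundedDomain d)
    {Y : Type*} [NormedAddCommGroup Y] [InnerProductSpace ℝ Y] [CompleteSpace Y]
    (A : Lp ℝ 1 Ω.measure →L[ℝ] Y) (y : Y)
    (hy : ∃ x : Lp ℝ 1 Ω.measure, A x = y ∧ EntropicDual.entropyFunctional x < ⊤) :
    (∃! xdag : Lp ℝ 1 Ω.measure, EntropicDual.IsEntropySolution A y xdag) ∧
    ∀ xdag : Lp ℝ 1 Ω.measure, EntropicDual.IsEntropySolution A y xdag →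
      -- (i) a priori stopping; the step size condition is `γ ≤ 1 / ‖A‖ ^ 2`
      (∀ γ : ℝ, 0 < γ → γ * ‖A‖ ^ 2 ≤ 1 →
        (∀ (yd : ℝ → Y) (n : ℝ → ℕ), (∀ δ > 0, ‖yd δ - y‖ ≤ δ) →
          Tendsto n (𝓝[>] 0) atTop →
          Tendsto (fun δ : ℝ => δ ^ 2 * (n δ : ℝ)) (𝓝[>] 0) (𝓝 0) →
          Tendsto (fun δ : ℝ => ‖EntropicDual.primalIterate A γ (yd δ) (n δ) - xdag‖)
            (𝓝[>] 0) (𝓝 0)) ∧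
        (EntropicDual.SourceCondition A xdag →
          ∀ c₁ c₂ : ℝ, 0 < c₁ → c₁ ≤ c₂ →
            ∃ C : ℝ, ∀ δ > 0, ∀ yd : Y, ‖yd - y‖ ≤ δ →
              ∀ n : ℕ, c₁ * δ⁻¹ ≤ (n : ℝ) → (n : ℝ) ≤ c₂ * δ⁻¹ →
                ‖EntropicDual.primalIterate A γ yd n - xdag‖ ≤ C * δ ^ (1 / 2 : ℝ))) ∧
      -- (ii) the discrepancy principle
      (∀ τ γ : ℝ, 1 < τ → 0 < γ → 0 < 1 - 2 / τ - ‖A‖ ^ 2 * γ →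
        (∀ δ > 0, ∀ yd : Y, ‖yd - y‖ ≤ δ →
          ∃! n : ℕ, EntropicDual.IsDiscrepancyIndex A γ τ δ yd n) ∧
        (∀ (yd : ℝ → Y) (n : ℝ → ℕ), (∀ δ > 0, ‖yd δ - y‖ ≤ δ) →
          (∀ δ > 0, EntropicDual.IsDiscrepancyIndex A γ τ δ (yd δ) (n δ)) →
          Tendsto (fun δ : ℝ => ‖EntropicDual.primalIterate A γ (yd δ) (n δ) - xdag‖)
            (𝓝[>] 0) (𝓝 0)) ∧
        (EntropicDual.SourceCondition A xdag →
          ∃ C : ℝ, ∀ δ > 0, ∀ yd : Y, ‖yd - y‖ ≤ δ →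
            ∀ n : ℕ, EntropicDual.IsDiscrepancyIndex A γ τ δ yd n →
              ‖EntropicDual.primalIterate A γ yd n - xdag‖ ≤ C * δ ^ (1 / 2 : ℝ))) := by
  obtain ⟨z, hzy, hzfin⟩ := hy
  have hz := EntropicDual.isAdmissible_of_entropyFunctional_lt_top hzfin
  have := EntropicDual.neZero_of_mem_densities hz.1
  refine ⟨EntropicDual.existsUnique_isEntropySolution hz hzy, fun xdag hxdag => ?_⟩
  obtain ⟨hx, hdual⟩ := hxdag.spec hz hzy
  obtain ⟨rfl, -⟩ := hxdag
  refine ⟨fun γ hγ hA => ⟨?_, ?_⟩, fun τ γ hτ hγ hA => ⟨?_, ?_, ?_⟩⟩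
  · intro yd n hyd hn hn'
    exact EntropicDual.tendsto_primalIterate_apriori hx hdual hγ hA hyd hn hn'
  · intro hsrc c₁ c₂ hc₁ _
    obtain ⟨v, hv⟩ := hsrc.exists_klGibbs_eq_zero hx.1
    exact ⟨_, fun δ hδ yd hyd n h₁ h₂ =>
      EntropicDual.norm_primalIterate_sub_le_apriori hx hv hγ hA hc₁ hδ hyd h₁ h₂⟩
  · intro δ hδ yd hyd
    exact EntropicDual.existsUnique_isDiscrepancyIndex hx hτ hγ hA hδ hyd
  · intro yd n hyd hn
    exact EntropicDual.tendsto_primalIterate_discrepancy hx hdual hτ hγ hA hyd hn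
  · intro hsrc
    obtain ⟨v, hv⟩ := hsrc.exists_klGibbs_eq_zero hx.1
    exact ⟨_, fun δ hδ yd hyd n hn =>
      EntropicDual.norm_primalIterate_sub_le_discrepancy hx hv hτ hγ hA hδ hyd hn⟩
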